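/- Let $\mathcal H$ be a finite-dimensional complex Hilbert space, let $M_0\subseteq B(\mathcal H)$ be a unital $*$-subalgebra, and let $E:B(\mathcal H)\to M_0$ be the trace-preserving conditional expectation, i.e. the unique positive linear projection onto $M_0$ with $E(AXB)=A\,E(X)\,B$ for $A,B\in M_0$ and $\mathrm{Tr}\,E(X)=\mathrm{Tr}\,X$ for all $X\in B(\mathcal H)$. Let $\rho_0,\rho_1\in B(\mathcal H)$ be invertible density matrices (positive operators of trace one). For positive invertible $\sigma_0$ and positive $\sigma_1$ put $d_{\sigma_0,\sigma_1}=\sigma_0^{-1/2}\sigma_1\sigma_0^{-1/2}$ and let $$S_{BS}(\sigma_1,\sigma_0)=-\mathrm{Tr}\,\sigma_0\,\eta(d_{\sigma_0,\sigma_1}),\qquad \eta(x)=-x\log x \quad (\eta(0)=0),$$ be the Belavkin–Staszewski relative entropy. Let $$E_{\rho_0}(X)=E(\rho_0)^{-1/2}\,E(\rho_0^{1/2}X\rho_0^{1/2})\,E(\rho_0)^{-1/2},\qquad X\in B(\mathcal H),$$ be the generalized conditional expectation, and let $$N_{\rho_0}=\{X\in B(\mathcal H): E_{\rho_0}(X^*X)=E_{\rho_0}(X)^*E_{\rho_0}(X),\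 E_{\rho_0}(XX^*)=E_{\rho_0}(X)E_{\rho_0}(X)^*\}$$ be its multiplicative domain. Then the following are equivalent: (i) $S_{BS}(\rho_1,\rho_0)=S_{BS}(E(\rho_1),E(\rho_0))$; (ii) $d_{\rho_0,\rho_1}\in N_{\rho_0}$; (iii) $\rho_1\rho_0^{-1}\in M_0$; (iv) $\rho_1\rho_0^{-1}=E(\rho_1)E(\rho_0)^{-1}$. -/

import Mathlib

namespace QuantumBS

set_option linter.unusedSectionVars false

variable {H : Type*} [NormedAddCommGroup H] [InnerProductSpace ℂ H] [CompleteSpace H]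
  [FiniteDimensional ℂ H]

/-- The trace of an operator on `H`, as a linear functional on `B(H)`. -/
noncomputable def tr : (H →L[ℂ] H) →ₗ[ℂ] ℂ where
  toFun X := LinearMap.trace ℂ H (X : H →ₗ[ℂ] H)
  map_add' X Y := by simp
  map_smul' c X := by simp

/-- A density matrix: a positive operator of trace one. -/
structure IsDensity (ρ : H →L[ℂ] H) : Prop where
  nonneg : 0 ≤ ρ
  tr_eq_one : tr ρ = 1

/-- `E` is a trace preserving conditional expectation of `B(H)` onto the (unital) *-subalgebra
`M₀`: a positive linear projection onto `M₀` that is an `M₀`-bimodule map and preserves the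
trace. -/
structure IsTracePreservingCondExp (M₀ : StarSubalgebra ℂ (H →L[ℂ] H))
    (E : (H →L[ℂ] H) →ₗ[ℂ] (H →L[ℂ] H)) : Prop where
  mem : ∀ X, E X ∈ M₀
  apply_of_mem : ∀ X ∈ M₀, E X = X
  bimodule : ∀ A ∈ M₀, ∀ B ∈ M₀, ∀ X, E (A * X * B) = A * E X * B
  nonneg : ∀ X, 0 ≤ X → 0 ≤ E X
  tr_apply : ∀ X, tr (E X) = tr X

theorem tr_mul_comm (X Y : H →L[ℂ] H) : tr (X * Y) = tr (Y * X) :=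
  LinearMap.trace_mul_comm ℂ (X : H →ₗ[ℂ] H) (Y : H →ₗ[ℂ] H)

theorem tr_star_mul_self_eq_zero {X : H →L[ℂ] H} (h : tr (star X * X) = 0) : X = 0 := by
  let b := stdOrthonormalBasis ℂ H
  have h1 : tr (star X * X) = ∑ i, ((‖X (b i)‖ ^ 2 : ℝ) : ℂ) := by
    change LinearMap.trace ℂ H _ = _
    rw [LinearMap.trace_eq_sum_inner _ b]
    refine Finset.sum_congr rfl fun i _ => ?_
    change inner ℂ (b i) ((ContinuousLinearMap.adjoint X) (X (b i))) = _
    rw [ContinuousLinearMap.adjoint_inner_right, inner_self_eq_norm_sq_to_K]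
    push_cast
    rfl
  rw [h1, ← Complex.ofReal_sum, Complex.ofReal_eq_zero,
    Finset.sum_eq_zero_iff_of_nonneg (fun i _ => by positivity)] at h
  have h2 : (X : H →ₗ[ℂ] H) = 0 := by
    apply b.toBasis.ext
    intro i
    have := h i (Finset.mem_univ i)
    simpa using this
  ext v
  exact congrArg (fun f : H →ₗ[ℂ] H => f v) h2

open scoped ComplexOrder in
theorem tr_nonneg {X : H →L[ℂ] H} (h : 0 ≤ X) : 0 ≤ tr X := by
  have h' := (ContinuousLinearMap.nonneg_iff_isPositive X).1 h
  exact LinearMap.IsPositive.trace_nonneg (f := (X : H →ₗ[ℂ] H)) h'.toLinearMap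

theorem isClosed_coe (M₀ : StarSubalgebra ℂ (H →L[ℂ] H)) :
    IsClosed (M₀ : Set (H →L[ℂ] H)) :=
  (M₀.toSubalgebra.toSubmodule).closed_of_finiteDimensional

theorem eq_of_tr_mul_eq (M₀ : StarSubalgebra ℂ (H →L[ℂ] H)) {X Y : H →L[ℂ] H}
    (hX : X ∈ M₀) (hY : Y ∈ M₀) (h : ∀ A ∈ M₀, tr (A * X) = tr (A * Y)) : X = Y := by
  rw [← sub_eq_zero]
  apply tr_star_mul_self_eq_zero
  rw [mul_sub, map_sub, h _ (star_mem (sub_mem hX hY)), sub_self]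

theorem exists_hilbertSchmidt_projection (M₀ : StarSubalgebra ℂ (H →L[ℂ] H)) :
    ∃ E : (H →L[ℂ] H) →ₗ[ℂ] (H →L[ℂ] H),
      (∀ X, E X ∈ M₀) ∧ ∀ X, ∀ A ∈ M₀, tr (A * E X) = tr (A * X) := by
  let S : Submodule ℂ (H →L[ℂ] H) := M₀.toSubalgebra.toSubmodule
  let T : (H →L[ℂ] H) →ₗ[ℂ] Module.Dual ℂ S :=
    LinearMap.mk₂ ℂ (fun (X : H →L[ℂ] H) (A : S) => tr ((A : H →L[ℂ] H) * X))
      (by intros; simp [mul_add]) (by intros; simp) (by intros; simp [add_mul])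
      (by intros; simp)
  have hinj : Function.Injective (T ∘ₗ S.subtype) := by
    intro X Y hXY
    apply Subtype.ext
    refine eq_of_tr_mul_eq M₀ X.2 Y.2 fun A hA => ?_
    exact congrArg (fun f : Module.Dual ℂ S => f ⟨A, hA⟩) hXY
  let e : S ≃ₗ[ℂ] Module.Dual ℂ S :=
    LinearEquiv.ofInjectiveOfFinrankEq (T ∘ₗ S.subtype) hinj Subspace.dual_finrank_eq.symm
  have he : ∀ x, e x = T (x : H →L[ℂ] H) := fun x => rfl
  refine ⟨S.subtype ∘ₗ (e.symm : Module.Dual ℂ S →ₗ[ℂ] S) ∘ₗ T, fun X => (e.symm (T X)).2,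
    fun X A hA => ?_⟩
  have h := he (e.symm (T X))
  rw [LinearEquiv.apply_symm_apply] at h
  exact (congrArg (fun f : Module.Dual ℂ S => f ⟨A, hA⟩) h).symm

open scoped ComplexOrder in
/-- There is exactly one trace preserving conditional expectation onto `M₀`. -/
theorem existsUnique_condExp (M₀ : StarSubalgebra ℂ (H →L[ℂ] H)) :
    ∃! E : (H →L[ℂ] H) →ₗ[ℂ] (H →L[ℂ] H), IsTracePreservingCondExp M₀ E := by
  obtain ⟨E, hmem, hE⟩ := exists_hilbertSchmidt_projection M₀
  have key : ∀ X Y, Y ∈ M₀ → (∀ A ∈ M₀, tr (A * Y) = tr (A * X)) → E X = Y :=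
    fun X Y hY h => eq_of_tr_mul_eq M₀ (hmem X) hY fun A hA => by rw [hE X A hA, h A hA]
  refine ⟨E, ⟨hmem, fun X hX => key X X hX fun _ _ => rfl, ?_, ?_, ?_⟩, ?_⟩
  · intro A hA B hB X
    refine key _ _ (mul_mem (mul_mem hA (hmem X)) hB) fun C hC => ?_
    calc tr (C * (A * E X * B)) = tr (C * A * E X * B) := by simp only [mul_assoc]
      _ = tr (B * C * A * E X) := by rw [tr_mul_comm]; simp only [mul_assoc]
      _ = tr (B * C * A * X) := hE X _ (mul_mem (mul_mem hB hC) hA)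
      _ = tr (C * A * X * B) := by rw [tr_mul_comm _ B]; simp only [mul_assoc]
      _ = tr (C * (A * X * B)) := by simp only [mul_assoc]
  · intro X hX
    have hconj : ∀ Y : H →L[ℂ] H, tr (star Y) = star (tr Y) := by
      intro Y
      let b := stdOrthonormalBasis ℂ H
      change LinearMap.trace ℂ H _ = star (LinearMap.trace ℂ H _)
      rw [LinearMap.trace_eq_sum_inner _ b, LinearMap.trace_eq_sum_inner _ b, star_sum]
      refine Finset.sum_congr rfl fun i _ => ?_
      change inner ℂ (b i) ((ContinuousLinearMap.adjoint Y) (b i)) = _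
      rw [ContinuousLinearMap.adjoint_inner_right]
      exact (inner_conj_symm _ _).symm
    have hsa : IsSelfAdjoint (E X) := by
      refine (key X _ (star_mem (hmem X)) fun A hA => ?_).symm
      have hXs : star X = X := (IsSelfAdjoint.of_nonneg hX)
      calc tr (A * star (E X)) = star (tr (star A * E X)) := by
            rw [← hconj, star_mul, star_star, tr_mul_comm]
        _ = star (tr (star A * X)) := by rw [hE X _ (star_mem hA)]
        _ = tr (A * X) := by rw [← hconj, star_mul, star_star, hXs, tr_mul_comm]
    have hcl : IsClosed (M₀ : Set (H →L[ℂ] H)) := isClosed_coe M₀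
    have hN : (E X)⁻ ∈ M₀ := by
      rw [CFC.negPart_def, cfcₙ_eq_cfc, cfc_real_eq_complex]
      exact cfc_mem _ (hmem X)
    rw [← CFC.negPart_eq_zero_iff (E X) hsa]
    have hNsa : star (E X)⁻ = (E X)⁻ := IsSelfAdjoint.of_nonneg (CFC.negPart_nonneg (E X))
    apply tr_star_mul_self_eq_zero
    set N := (E X)⁻ with hNdef
    have h1 : N * E X * N = -(N * (N * N)) := by
      conv_lhs => rw [← CFC.posPart_sub_negPart (E X) hsa]
      rw [mul_sub, CFC.negPart_mul_posPart, ← hNdef]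
      simp [mul_assoc]
    have h2 : N * E X = -(star N * N) := by
      conv_lhs => rw [← CFC.posPart_sub_negPart (E X) hsa]
      rw [mul_sub, CFC.negPart_mul_posPart, ← hNdef, hNsa]
      simp
    have h3 : 0 ≤ tr (N * X) := by
      have hs : CFC.sqrt N * CFC.sqrt N = N :=
        CFC.sqrt_mul_sqrt_self N (CFC.negPart_nonneg (E X))
      have hss : star (CFC.sqrt N) = CFC.sqrt N := IsSelfAdjoint.of_nonneg (CFC.sqrt_nonneg N)
      have : tr (N * X) = tr (star (CFC.sqrt N) * X * CFC.sqrt N) := by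
        rw [hss, tr_mul_comm _ (CFC.sqrt N), ← mul_assoc, hs]
      rw [this]
      exact tr_nonneg (star_left_conjugate_nonneg hX _)
    rw [← hE X N hN, h2, map_neg] at h3
    have h4 : 0 ≤ tr (star N * N) := tr_nonneg (star_mul_self_nonneg N)
    exact le_antisymm (neg_nonneg.1 h3) h4
  · intro X
    simpa using hE X 1 (one_mem M₀)
  · intro F hF
    refine LinearMap.ext fun X => (key X _ (hF.mem X) fun A hA => ?_).symm
    have h := hF.bimodule A hA 1 (one_mem M₀) X
    rw [mul_one, mul_one] at h
    rw [← h, hF.tr_apply]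

/-- The trace preserving conditional expectation `E : B(H) → M₀`. -/
noncomputable def condExp (M₀ : StarSubalgebra ℂ (H →L[ℂ] H)) :
    (H →L[ℂ] H) →ₗ[ℂ] (H →L[ℂ] H) :=
  (existsUnique_condExp M₀).choose

theorem isTracePreservingCondExp_condExp (M₀ : StarSubalgebra ℂ (H →L[ℂ] H)) :
    IsTracePreservingCondExp M₀ (condExp M₀) :=
  (existsUnique_condExp M₀).choose_spec.1

/-- The sesquilinear form `⟨X, Y⟩_ρ = Tr X* ρ^{1/2} Y ρ^{1/2}`. -/
noncomputable def innerρ (ρ X Y : H →L[ℂ] H) : ℂ :=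
  tr (star X * ρ ^ (1 / 2 : ℝ) * Y * ρ ^ (1 / 2 : ℝ))

/-- The generalized (Accardi-Cecchini) conditional expectation
`E_ρ(X) = E(ρ)^{-1/2} E(ρ^{1/2} X ρ^{1/2}) E(ρ)^{-1/2}`; for positive invertible `ρ` it is the
only map into `M₀` with `⟨X₀, Y⟩_ρ = ⟨X₀, E_ρ(Y)⟩_{E(ρ)}` for all `X₀ ∈ M₀`, as shown below. -/
noncomputable def genCondExp (M₀ : StarSubalgebra ℂ (H →L[ℂ] H)) (ρ X : H →L[ℂ] H) :
    H →L[ℂ] H :=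
  condExp M₀ ρ ^ (-(1 / 2) : ℝ) * condExp M₀ (ρ ^ (1 / 2 : ℝ) * X * ρ ^ (1 / 2 : ℝ)) *
    condExp M₀ ρ ^ (-(1 / 2) : ℝ)

/-- The multiplicative domain `N_ρ` of `E_ρ`. -/
def multDomain (M₀ : StarSubalgebra ℂ (H →L[ℂ] H)) (ρ : H →L[ℂ] H) : Set (H →L[ℂ] H) :=
  {X | genCondExp M₀ ρ (star X * X) = star (genCondExp M₀ ρ X) * genCondExp M₀ ρ X ∧
    genCondExp M₀ ρ (X * star X) = genCondExp M₀ ρ X * star (genCondExp M₀ ρ X)}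

/-- The Radon-Nikodym derivative `d_{ρ₀,ρ₁} = ρ₀^{-1/2} ρ₁ ρ₀^{-1/2}` of `ρ₁` with respect to
`ρ₀`. -/
noncomputable def rnDeriv (ρ₀ ρ₁ : H →L[ℂ] H) : H →L[ℂ] H :=
  ρ₀ ^ (-(1 / 2) : ℝ) * ρ₁ * ρ₀ ^ (-(1 / 2) : ℝ)

/-- The Belavkin-Staszewski relative entropy `S_BS(ρ₁, ρ₀) = - Tr ρ₀ η(d_{ρ₀,ρ₁})` with
`η(x) = - x log x`, for `ρ₀` positive and invertible. The trace is real for self-adjoint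
arguments. -/
noncomputable def bsEntropy (ρ₁ ρ₀ : H →L[ℂ] H) : ℝ :=
  -(tr (ρ₀ * cfc Real.negMulLog (rnDeriv ρ₀ ρ₁))).re

theorem isStrictlyPositive_condExp (M₀ : StarSubalgebra ℂ (H →L[ℂ] H)) {ρ : H →L[ℂ] H}
    (hρ : IsStrictlyPositive ρ) : IsStrictlyPositive (condExp M₀ ρ) := by
  have hE := isTracePreservingCondExp_condExp M₀
  rcases subsingleton_or_nontrivial (H →L[ℂ] H) with hsub | hnt
  · rwa [Subsingleton.elim (condExp M₀ ρ) ρ]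
  obtain ⟨r, hr, hle⟩ := (CFC.exists_pos_algebraMap_le_iff hρ.nonneg.isSelfAdjoint).2
    (fun x hx => hρ.spectrum_pos hx)
  have h1 : 0 ≤ condExp M₀ (ρ - algebraMap ℝ (H →L[ℂ] H) r) := hE.nonneg _ (sub_nonneg.2 hle)
  have h2 : algebraMap ℝ (H →L[ℂ] H) r ∈ M₀ := by
    have : algebraMap ℝ (H →L[ℂ] H) r = algebraMap ℂ (H →L[ℂ] H) (r : ℂ) :=
      IsScalarTower.algebraMap_apply ℝ ℂ (H →L[ℂ] H) r
    rw [this]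
    exact algebraMap_mem M₀ _
  rw [map_sub, hE.apply_of_mem _ h2, sub_nonneg] at h1
  exact IsStrictlyPositive.of_le (isStrictlyPositive_algebraMap hr) h1

theorem genCondExp_mem (M₀ : StarSubalgebra ℂ (H →L[ℂ] H)) {ρ : H →L[ℂ] H}
    (hρ : 0 ≤ ρ) (Y : H →L[ℂ] H) : genCondExp M₀ ρ Y ∈ M₀ := by
  have hE := isTracePreservingCondExp_condExp M₀
  have hcl : IsClosed (M₀ : Set (H →L[ℂ] H)) := isClosed_coe M₀
  have h : condExp M₀ ρ ^ (-(1 / 2) : ℝ) ∈ M₀ := by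
    rw [CFC.rpow_eq_cfc_real (hE.nonneg ρ hρ),
      cfc_real_eq_complex _ (hE.nonneg ρ hρ).isSelfAdjoint]
    exact cfc_mem _ (hE.mem ρ)
  exact mul_mem (mul_mem h (hE.mem _)) h

/-- The defining identity of the generalized conditional expectation. -/
theorem innerρ_genCondExp (M₀ : StarSubalgebra ℂ (H →L[ℂ] H)) {ρ : H →L[ℂ] H}
    (hρ : IsStrictlyPositive ρ) {X₀ : H →L[ℂ] H} (hX₀ : X₀ ∈ M₀) (Y : H →L[ℂ] H) :
    innerρ ρ X₀ Y = innerρ (condExp M₀ ρ) X₀ (genCondExp M₀ ρ Y) := by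
  have hE := isTracePreservingCondExp_condExp M₀
  have hσ := isStrictlyPositive_condExp M₀ hρ
  have h1 := CFC.rpow_mul_rpow_neg (1 / 2 : ℝ) hσ
  have h2 := CFC.rpow_neg_mul_rpow (1 / 2 : ℝ) hσ
  set Z := ρ ^ (1 / 2 : ℝ) * Y * ρ ^ (1 / 2 : ℝ) with hZ
  have h3 : innerρ (condExp M₀ ρ) X₀ (genCondExp M₀ ρ Y) = tr (star X₀ * condExp M₀ Z) := by
    unfold innerρ genCondExp
    rw [← hZ]
    congr 1
    calc _ = star X₀ * (condExp M₀ ρ ^ (1 / 2 : ℝ) * condExp M₀ ρ ^ (-(1 / 2) : ℝ)) *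
          condExp M₀ Z * (condExp M₀ ρ ^ (-(1 / 2) : ℝ) * condExp M₀ ρ ^ (1 / 2 : ℝ)) := by
          simp only [mul_assoc]
      _ = _ := by rw [h1, h2, mul_one, mul_one]
  have h4 := hE.bimodule _ (star_mem hX₀) 1 (one_mem M₀) Z
  rw [mul_one, mul_one] at h4
  rw [h3, ← h4, hE.tr_apply, hZ]
  simp only [innerρ, mul_assoc]

/-- The defining identity determines the generalized conditional expectation. -/
theorem eq_genCondExp (M₀ : StarSubalgebra ℂ (H →L[ℂ] H)) {ρ : H →L[ℂ] H}
    (hρ : IsStrictlyPositive ρ) {Y Z : H →L[ℂ] H} (hZ : Z ∈ M₀)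
    (h : ∀ X₀ ∈ M₀, innerρ ρ X₀ Y = innerρ (condExp M₀ ρ) X₀ Z) : Z = genCondExp M₀ ρ Y := by
  have hE := isTracePreservingCondExp_condExp M₀
  have hσ := isStrictlyPositive_condExp M₀ hρ
  have h1 := CFC.rpow_mul_rpow_neg (1 / 2 : ℝ) hσ
  have h2 := CFC.rpow_neg_mul_rpow (1 / 2 : ℝ) hσ
  have hcl : IsClosed (M₀ : Set (H →L[ℂ] H)) := isClosed_coe M₀
  have hmem : ∀ y : ℝ, condExp M₀ ρ ^ y ∈ M₀ := fun y => by
    rw [CFC.rpow_eq_cfc_real hσ.nonneg, cfc_real_eq_complex _ hσ.nonneg.isSelfAdjoint]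
    exact cfc_mem _ (hE.mem ρ)
  set s := condExp M₀ ρ ^ (1 / 2 : ℝ) with hs
  set t := condExp M₀ ρ ^ (-(1 / 2) : ℝ) with ht
  have hG := genCondExp_mem M₀ hρ.nonneg Y
  have h3 : s * Z * s = s * genCondExp M₀ ρ Y * s := by
    refine eq_of_tr_mul_eq M₀ (mul_mem (mul_mem (hmem _) hZ) (hmem _))
      (mul_mem (mul_mem (hmem _) hG) (hmem _)) fun A hA => ?_
    have := (h _ (star_mem hA)).symm.trans (innerρ_genCondExp M₀ hρ (star_mem hA) Y)
    simpa only [innerρ, star_star, mul_assoc, ← hs] using this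
  have h4 : ∀ W : H →L[ℂ] H, t * (s * W * s) * t = W := fun W => by
    calc t * (s * W * s) * t = (t * s) * W * (s * t) := by simp only [mul_assoc]
      _ = W := by rw [h1, h2, one_mul, mul_one]
  rw [← h4 Z, h3, h4]

/-- The defining identity `Tr ρ₁ X = ⟨X*, d_{ρ₀,ρ₁}⟩_{ρ₀}` of the Radon-Nikodym derivative. -/
theorem tr_mul_eq_innerρ_rnDeriv {ρ₀ : H →L[ℂ] H} (hρ₀ : IsStrictlyPositive ρ₀)
    (ρ₁ X : H →L[ℂ] H) : tr (ρ₁ * X) = innerρ ρ₀ (star X) (rnDeriv ρ₀ ρ₁) := by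
  have h1 := CFC.rpow_mul_rpow_neg (1 / 2 : ℝ) hρ₀
  have h2 := CFC.rpow_neg_mul_rpow (1 / 2 : ℝ) hρ₀
  rw [tr_mul_comm]
  unfold innerρ rnDeriv
  rw [star_star]
  congr 1
  symm
  calc _ = X * (ρ₀ ^ (1 / 2 : ℝ) * ρ₀ ^ (-(1 / 2) : ℝ)) * ρ₁ *
        (ρ₀ ^ (-(1 / 2) : ℝ) * ρ₀ ^ (1 / 2 : ℝ)) := by simp only [mul_assoc]
    _ = _ := by rw [h1, h2, mul_one, mul_one]

end QuantumBS

namespace QuantumBS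

set_option linter.unusedSectionVars false

open Filter Topology

variable {H : Type*} [NormedAddCommGroup H] [InnerProductSpace ℂ H] [CompleteSpace H]
  [FiniteDimensional ℂ H]

/-! Write `A = ρ₁`, `B = ρ₀`, `d = B^{-1/2} A B^{-1/2}`. The difference of the two entropies is, up
to sign, a finite signed sum `∑ cᵢ η(xᵢ)` over the spectra of `d` and of its counterpart for `E(A)`,
`E(B)`. Trace preservation makes this sum vanish on affine functions, so that `∑ cᵢ η(xᵢ) = -∫₀^∞ t
∑ cᵢ (xᵢ + t)⁻¹ dt`, and only resolvents matter.

With `C = A + tB`, the resolvent sum is the gap `Tr B C⁻¹ B - Tr E(B) E(C)⁻¹ E(B)`. It equals `Tr T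
C T*` for `T = B C⁻¹ - E(B) E(C)⁻¹`, hence is nonnegative, and zero only if `T = 0`. Taking inverses
and removing `t` turns `T = 0` into `A B⁻¹ = E(A) E(B)⁻¹`, whatever `t` is. This is (i) ⇔ (iv).

Condition (ii) says `E(A B⁻¹ A) = E(A) E(B)⁻¹ E(A)`, the equality case of the same gap for the pair
`(A, B)`. Condition (iii) gives (iv) by the bimodule property. -/

/-! ### A scalar criterion -/

/-- If a finite signed sum of point evaluations at positive reals vanishes on affine functions and
is nonnegative on all resolvents `x ↦ (x + t)⁻¹`, then it vanishes on `x ↦ -x log x` if and only if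
it vanishes on all resolvents. -/
theorem sum_negMulLog_eq_zero_iff {ι : Type*} [Fintype ι] {c x : ι → ℝ} (hx : ∀ i, 0 < x i)
    (h0 : ∑ i, c i = 0) (h1 : ∑ i, c i * x i = 0)
    (hres : ∀ t, 0 < t → 0 ≤ ∑ i, c i * (x i + t)⁻¹) :
    ∑ i, c i * Real.negMulLog (x i) = 0 ↔ ∀ t, 0 < t → ∑ i, c i * (x i + t)⁻¹ = 0 := by
  -- Up to sign, the tail integral from `t` to `∞` of `s ∑ cᵢ (xᵢ + s)⁻¹`; its value at `0` is the
  -- sum of the `η(xᵢ)`.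
  let P : ℝ → ℝ := fun t => ∑ i, -(c i * x i) * Real.log (x i + t)
  have hderiv : ∀ t, 0 ≤ t → HasDerivAt P (t * ∑ i, c i * (x i + t)⁻¹) t := by
    intro t ht
    have hsum : HasDerivAt P (∑ i, -(c i * x i) * (1 / (x i + t))) t := by
      refine HasDerivAt.fun_sum fun i _ => ?_
      exact ((((hasDerivAt_id' t).const_add (x i)).log
        (by have := hx i; positivity)).const_mul _)
    convert hsum using 1
    have : ∑ i, -(c i * x i) * (1 / (x i + t)) =
        ∑ i, (t * (c i * (x i + t)⁻¹) - c i) := by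
      refine Finset.sum_congr rfl fun i _ => ?_
      have : x i + t ≠ 0 := by have := hx i; positivity
      field_simp
      ring
    rw [this, Finset.sum_sub_distrib, h0, sub_zero, Finset.mul_sum]
  have hcont : ContinuousOn P (Set.Ici 0) := fun t ht =>
    (hderiv t ht).continuousAt.continuousWithinAt
  have hmono : MonotoneOn P (Set.Ici 0) := by
    refine monotoneOn_of_deriv_nonneg (convex_Ici 0) hcont ?_ ?_
    · rw [interior_Ici]
      exact fun t ht => (hderiv t (le_of_lt ht)).differentiableAt.differentiableWithinAt
    · rw [interior_Ici]
      intro t ht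
      rw [(hderiv t (le_of_lt ht)).deriv]
      exact mul_nonneg (le_of_lt ht) (hres t ht)
  have hzero : P 0 = ∑ i, c i * Real.negMulLog (x i) := by
    refine Finset.sum_congr rfl fun i _ => ?_
    rw [add_zero, Real.negMulLog]
    ring
  have hlim : Tendsto P atTop (𝓝 0) := by
    -- Subtracting `log t` from every logarithm changes nothing, because `∑ cᵢ xᵢ = 0`.
    have h2 : Tendsto (fun t : ℝ => ∑ i, -(c i * x i) * (Real.log (t + x i) - Real.log t))
        atTop (𝓝 (∑ i, -(c i * x i) * 0)) :=
      tendsto_finsetSum _ fun i _ =>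
        (Real.tendsto_log_comp_add_sub_log (x i)).const_mul _
    simp only [mul_zero, Finset.sum_const_zero] at h2
    refine h2.congr fun t => ?_
    simp only [mul_sub, Finset.sum_sub_distrib, ← Finset.sum_mul, Finset.sum_neg_distrib, h1, P]
    simp only [neg_zero, zero_mul, sub_zero, add_comm t]
  rw [← hzero]
  constructor
  · intro hP t ht
    -- A monotone function that starts at `0` and tends to `0` is zero, and so is its derivative.
    have hconst : ∀ s, 0 ≤ s → P s = 0 := by
      intro s hs
      refine le_antisymm (ge_of_tendsto hlim ?_) ?_
      · filter_upwards [eventually_ge_atTop s] with u hu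
        exact hmono hs (hs.trans hu) hu
      · rw [← hP]
        exact hmono (Set.self_mem_Ici) hs hs
    have hd : HasDerivAt P 0 t := by
      refine (hasDerivAt_const t (0 : ℝ)).congr_of_eventuallyEq ?_
      filter_upwards [Ioi_mem_nhds ht] with s hs using hconst s (le_of_lt hs)
    exact (mul_eq_zero.1 ((hderiv t ht.le).unique hd)).resolve_left ht.ne'
  · intro hg
    have hanti : AntitoneOn P (Set.Ici 0) := by
      refine antitoneOn_of_deriv_nonpos (convex_Ici 0) hcont ?_ ?_
      · rw [interior_Ici]
        exact fun t ht => (hderiv t (le_of_lt ht)).differentiableAt.differentiableWithinAt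
      · rw [interior_Ici]
        intro t ht
        rw [(hderiv t (le_of_lt ht)).deriv, hg t ht, mul_zero]
    refine tendsto_nhds_unique (tendsto_const_nhds.congr' ?_) hlim
    filter_upwards [eventually_ge_atTop 0] with u hu
    exact le_antisymm (hmono Set.self_mem_Ici hu hu) (hanti Set.self_mem_Ici hu hu)

/-! ### Functional calculus in finite dimension -/

/-- Every function is continuous on a finite set, which settles the continuity conditions of the
functional calculus. -/
theorem finite_spectrum_real (a : H →L[ℂ] H) : (spectrum ℝ a).Finite := by
  have h : (spectrum ℂ a).Finite := by
    rw [← AlgEquiv.spectrum_eq (Module.End.toContinuousLinearMap H).symm a]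
    exact Module.End.finite_spectrum _
  rw [← spectrum.preimage_algebraMap ℂ]
  exact h.preimage (FaithfulSMul.algebraMap_injective ℝ ℂ).injOn

/-- `h ↦ Re Tr(B h(a))` is a weighted sum of the values of `h` on the spectrum of `a`. -/
theorem exists_re_tr_mul_cfc_eq_sum (a B : H →L[ℂ] H) :
    ∃ w : spectrum ℝ a → ℝ, ∀ [Fintype (spectrum ℝ a)] (h : ℝ → ℝ),
      (tr (B * cfc h a)).re = ∑ i, w i * h i := by
  classical
  have hfin := finite_spectrum_real a
  -- The weights come from the spectral projections of `a`. If `a` is not self-adjoint, `cfc` is `0`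
  -- and both sides vanish.
  refine ⟨fun i => (tr (B * cfc (Pi.single (i : ℝ) (1 : ℝ)) a)).re, fun h => ?_⟩
  have hcfc : cfc h a = ∑ i : spectrum ℝ a, h i • cfc (Pi.single (i : ℝ) (1 : ℝ)) a := by
    have : cfc h a =
        cfc (∑ i : spectrum ℝ a, fun y => h i * Pi.single (M := fun _ => ℝ) (i : ℝ) 1 y) a := by
      refine cfc_congr fun y hy => ?_
      rw [Finset.sum_apply, Finset.sum_eq_single ⟨y, hy⟩]
      · simp
      · intro j _ hj
        have : y ≠ j := fun e => hj (Subtype.ext e.symm)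
        simp [this]
      · simp
    rw [this, cfc_sum _ _ _ fun _ _ => hfin.continuousOn _]
    exact Finset.sum_congr rfl fun i _ => cfc_const_mul _ _ _ (hfin.continuousOn _)
  rw [hcfc, Finset.mul_sum, map_sum, Complex.re_sum]
  refine Finset.sum_congr rfl fun i _ => ?_
  have : h i • cfc (Pi.single (i : ℝ) (1 : ℝ)) a =
      ((h i : ℝ) : ℂ) • cfc (Pi.single (i : ℝ) (1 : ℝ)) a := (Complex.coe_smul _ _).symm
  rw [this, mul_smul_comm, map_smul, smul_eq_mul, Complex.re_ofReal_mul, mul_comm]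

theorem rpow_half_mul_self {B : H →L[ℂ] H} (hB : IsStrictlyPositive B) :
    B ^ (1 / 2 : ℝ) * B ^ (1 / 2 : ℝ) = B := by
  rw [← CFC.rpow_add hB.isUnit, add_halves, CFC.rpow_one B hB.nonneg]

theorem isStrictlyPositive_rnDeriv {A B : H →L[ℂ] H} (hA : IsStrictlyPositive A)
    (hB : IsStrictlyPositive B) : IsStrictlyPositive (rnDeriv B A) := by
  have h := IsStrictlyPositive.rpow B (-(1 / 2) : ℝ) hB
  refine ((h.isUnit.mul hA.isUnit).mul h.isUnit).isStrictlyPositive ?_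
  have h2 := star_left_conjugate_nonneg hA.nonneg (B ^ (-(1 / 2) : ℝ))
  rwa [h.nonneg.isSelfAdjoint] at h2

theorem tr_mul_rnDeriv {A B : H →L[ℂ] H} (hB : IsStrictlyPositive B) :
    tr (B * rnDeriv B A) = tr A := by
  have h := tr_mul_eq_innerρ_rnDeriv hB A 1
  rw [mul_one] at h
  rw [h, innerρ, star_star, one_mul, tr_mul_comm (_ * _), ← mul_assoc, rpow_half_mul_self hB]

/-- `Tr B (d + t)⁻¹ = Tr B (A + t B)⁻¹ B` for `d = B^{-1/2} A B^{-1/2}`. -/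
theorem tr_mul_cfc_resolvent {A B : H →L[ℂ] H} (hA : IsStrictlyPositive A)
    (hB : IsStrictlyPositive B) {t : ℝ} (ht : 0 < t) :
    tr (B * cfc (fun x : ℝ => (x + t)⁻¹) (rnDeriv B A)) =
      tr (B * Ring.inverse (A + t • B) * B) := by
  have h1 := CFC.rpow_mul_rpow_neg (1 / 2 : ℝ) hB
  have h2 := CFC.rpow_neg_mul_rpow (1 / 2 : ℝ) hB
  have hs := rpow_half_mul_self hB
  have hd := isStrictlyPositive_rnDeriv hA hB
  have hC : IsStrictlyPositive (A + t • B) := hA.add_nonneg (IsStrictlyPositive.smul ht hB).nonneg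
  have hfin := finite_spectrum_real (rnDeriv B A)
  -- Both `(d + t)⁻¹` from the functional calculus and `B^{1/2} (A + tB)⁻¹ B^{1/2}` invert `d + t`,
  -- hence they agree.
  have hRd : cfc (fun x : ℝ => (x + t)⁻¹) (rnDeriv B A) * (rnDeriv B A + t • 1) = 1 := by
    have : rnDeriv B A + t • 1 = cfc (fun x : ℝ => x + t) (rnDeriv B A) := by
      rw [cfc_add_const t (fun x => x) _ (hfin.continuousOn _) hd.nonneg.isSelfAdjoint,
        cfc_id' ℝ _ hd.nonneg.isSelfAdjoint, Algebra.algebraMap_eq_smul_one]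
    rw [this, ← cfc_mul _ _ _ (hfin.continuousOn _) (hfin.continuousOn _),
      ← cfc_const_one ℝ (rnDeriv B A) hd.nonneg.isSelfAdjoint]
    refine cfc_congr fun x hx => ?_
    have := hd.spectrum_pos hx
    exact inv_mul_cancel₀ (by positivity)
  have hdC : (rnDeriv B A + t • 1) * (B ^ (1 / 2 : ℝ) * Ring.inverse (A + t • B) *
      B ^ (1 / 2 : ℝ)) = 1 := by
    have : rnDeriv B A + t • 1 =
        B ^ (-(1 / 2) : ℝ) * (A + t • B) * B ^ (-(1 / 2) : ℝ) := by
      have h3 : B ^ (-(1 / 2) : ℝ) * B * B ^ (-(1 / 2) : ℝ) = 1 := by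
        conv_lhs => enter [1, 2]; rw [← hs]
        rw [← mul_assoc, h2, one_mul, h1]
      rw [rnDeriv, mul_add, add_mul, mul_smul_comm, smul_mul_assoc, h3]
    rw [this]
    calc _ = B ^ (-(1 / 2) : ℝ) * ((A + t • B) * (B ^ (-(1 / 2) : ℝ) * B ^ (1 / 2 : ℝ)) *
          Ring.inverse (A + t • B)) * B ^ (1 / 2 : ℝ) := by simp only [mul_assoc]
      _ = _ := by rw [h2, mul_one, Ring.mul_inverse_cancel _ hC.isUnit, mul_one, h2]
  rw [left_inv_eq_right_inv hRd hdC]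
  calc _ = tr ((B * B ^ (1 / 2 : ℝ) * Ring.inverse (A + t • B)) * B ^ (1 / 2 : ℝ)) := by
        simp only [mul_assoc]
    _ = tr ((B ^ (1 / 2 : ℝ) * B) * B ^ (1 / 2 : ℝ) * Ring.inverse (A + t • B)) := by
        rw [tr_mul_comm]; simp only [mul_assoc]
    _ = tr (B * (B * Ring.inverse (A + t • B))) := by
        conv_lhs => enter [2, 1, 1, 2]; rw [← hs]
        congr 1
        calc _ = (B ^ (1 / 2 : ℝ) * B ^ (1 / 2 : ℝ)) * (B ^ (1 / 2 : ℝ) * B ^ (1 / 2 : ℝ)) *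
              Ring.inverse (A + t • B) := by simp only [mul_assoc]
          _ = _ := by rw [hs, mul_assoc]
    _ = _ := tr_mul_comm _ _

/-! ### Monotonicity of `(B, C) ↦ Tr B C⁻¹ B` under the conditional expectation -/

section CondExp

variable (M₀ : StarSubalgebra ℂ (H →L[ℂ] H))

theorem condExp_mul_left {A : H →L[ℂ] H} (hA : A ∈ M₀) (X : H →L[ℂ] H) :
    condExp M₀ (A * X) = A * condExp M₀ X := by
  have h := (isTracePreservingCondExp_condExp M₀).bimodule A hA 1 (one_mem M₀) X
  rwa [mul_one, mul_one] at h

theorem condExp_mul_right {B : H →L[ℂ] H} (hB : B ∈ M₀) (X : H →L[ℂ] H) :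
    condExp M₀ (X * B) = condExp M₀ X * B := by
  have h := (isTracePreservingCondExp_condExp M₀).bimodule 1 (one_mem M₀) B hB X
  rwa [one_mul, one_mul] at h

/-- The inverse is a continuous function of `E(C)`, and `M₀`, closed by finite dimension, is stable
under the functional calculus. -/
theorem ringInverse_condExp_mem {C : H →L[ℂ] H} (hC : IsStrictlyPositive C) :
    Ring.inverse (condExp M₀ C) ∈ M₀ := by
  have hE := isTracePreservingCondExp_condExp M₀
  have hσ := isStrictlyPositive_condExp M₀ hC
  have hcl : IsClosed (M₀ : Set (H →L[ℂ] H)) := isClosed_coe M₀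
  have hfin := finite_spectrum_real (condExp M₀ C)
  have hinv : cfc (fun x : ℝ => x⁻¹) (condExp M₀ C) * condExp M₀ C = 1 := by
    conv_lhs => enter [2]; rw [← cfc_id' ℝ (condExp M₀ C) hσ.nonneg.isSelfAdjoint]
    rw [← cfc_mul _ _ _ (hfin.continuousOn _) (hfin.continuousOn _),
      ← cfc_const_one ℝ (condExp M₀ C) hσ.nonneg.isSelfAdjoint]
    exact cfc_congr fun x hx => inv_mul_cancel₀ (hσ.spectrum_pos hx).ne'
  rw [← left_inv_eq_right_inv hinv (Ring.mul_inverse_cancel _ hσ.isUnit),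
    cfc_real_eq_complex _ hσ.nonneg.isSelfAdjoint]
  exact cfc_mem _ (hE.mem C)

theorem star_ringInverse {C : H →L[ℂ] H} (hC : IsStrictlyPositive C) :
    star (Ring.inverse C) = Ring.inverse C := by
  rw [← Ring.inverse_star, hC.nonneg.isSelfAdjoint]

/-- With `T = B C⁻¹ - E(B) E(C)⁻¹` one has `E(T C T*) = E(B C⁻¹ B) - E(B) E(C)⁻¹ E(B)`. -/
theorem condExp_conjugate_sub {B C : H →L[ℂ] H} (hB : IsStrictlyPositive B)
    (hC : IsStrictlyPositive C) :
    condExp M₀ ((B * Ring.inverse C - condExp M₀ B * Ring.inverse (condExp M₀ C)) * C *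
        star (B * Ring.inverse C - condExp M₀ B * Ring.inverse (condExp M₀ C))) =
      condExp M₀ (B * Ring.inverse C * B) -
        condExp M₀ B * Ring.inverse (condExp M₀ C) * condExp M₀ B := by
  have hE := isTracePreservingCondExp_condExp M₀
  have hτ := isStrictlyPositive_condExp M₀ hB
  have hσ := isStrictlyPositive_condExp M₀ hC
  have hK := mul_mem (hE.mem B) (ringInverse_condExp_mem M₀ hC)
  have hK' := mul_mem (ringInverse_condExp_mem M₀ hC) (hE.mem B)
  have hexp : (B * Ring.inverse C - condExp M₀ B * Ring.inverse (condExp M₀ C)) * C *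
        star (B * Ring.inverse C - condExp M₀ B * Ring.inverse (condExp M₀ C)) =
      B * Ring.inverse C * B - B * (Ring.inverse (condExp M₀ C) * condExp M₀ B) -
        ((condExp M₀ B * Ring.inverse (condExp M₀ C)) * B -
        (condExp M₀ B * Ring.inverse (condExp M₀ C)) * C *
          (Ring.inverse (condExp M₀ C) * condExp M₀ B)) := by
    rw [star_sub, star_mul, star_mul, star_ringInverse hC, star_ringInverse hσ,
      hB.nonneg.isSelfAdjoint, hτ.nonneg.isSelfAdjoint, sub_mul, sub_mul, mul_sub, mul_sub,
      mul_assoc B _ C, Ring.inverse_mul_cancel _ hC.isUnit, mul_one, ← mul_assoc B,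
      mul_assoc (condExp M₀ B * _) C (Ring.inverse C * B), ← mul_assoc C,
      Ring.mul_inverse_cancel _ hC.isUnit, one_mul]
  -- By the bimodule property `E` sends both cross terms and the last term to `E(B) E(C)⁻¹ E(B)`;
  -- one copy survives, with a minus sign.
  rw [hexp, map_sub, map_sub, map_sub, condExp_mul_right M₀ hK', condExp_mul_right M₀ hK',
    condExp_mul_left M₀ hK, condExp_mul_left M₀ hK, mul_assoc (condExp M₀ B) _ (condExp M₀ C),
    Ring.inverse_mul_cancel _ hσ.isUnit, mul_one, ← mul_assoc, sub_self, sub_zero]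

/-- As a squared Hilbert–Schmidt norm of `C^{1/2} T*`, the trace is visibly nonnegative and
definite. -/
theorem tr_condExp_conjugate_eq (T : H →L[ℂ] H) {C : H →L[ℂ] H} (hC : IsStrictlyPositive C) :
    tr (condExp M₀ (T * C * star T)) =
      tr (star (C ^ (1 / 2 : ℝ) * star T) * (C ^ (1 / 2 : ℝ) * star T)) := by
  rw [(isTracePreservingCondExp_condExp M₀).tr_apply, star_mul, star_star,
    (IsStrictlyPositive.rpow C (1 / 2 : ℝ) hC).nonneg.isSelfAdjoint]
  conv_lhs => rw [← rpow_half_mul_self hC]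
  simp only [mul_assoc]

open scoped ComplexOrder in
theorem tr_gap_nonneg {B C : H →L[ℂ] H} (hB : IsStrictlyPositive B) (hC : IsStrictlyPositive C) :
    0 ≤ tr (B * Ring.inverse C * B) -
      tr (condExp M₀ B * Ring.inverse (condExp M₀ C) * condExp M₀ B) := by
  rw [← (isTracePreservingCondExp_condExp M₀).tr_apply (B * _ * _), ← map_sub,
    ← condExp_conjugate_sub M₀ hB hC, tr_condExp_conjugate_eq M₀ _ hC]
  exact tr_nonneg (star_mul_self_nonneg _)

theorem tr_gap_eq_zero_iff {B C : H →L[ℂ] H} (hB : IsStrictlyPositive B)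
    (hC : IsStrictlyPositive C) :
    tr (B * Ring.inverse C * B) -
        tr (condExp M₀ B * Ring.inverse (condExp M₀ C) * condExp M₀ B) = 0 ↔
      B * Ring.inverse C = condExp M₀ B * Ring.inverse (condExp M₀ C) := by
  rw [← (isTracePreservingCondExp_condExp M₀).tr_apply (B * _ * _), ← map_sub,
    ← condExp_conjugate_sub M₀ hB hC, tr_condExp_conjugate_eq M₀ _ hC]
  constructor
  · intro h
    -- `C^{1/2} T* = 0` forces `T = 0`, since `C^{1/2}` is invertible.
    have h2 := (IsStrictlyPositive.rpow C (1 / 2 : ℝ) hC).isUnit.mul_right_eq_zero.1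
      (tr_star_mul_self_eq_zero h)
    exact sub_eq_zero.1 (star_eq_zero.1 h2)
  · intro h
    rw [h, sub_self, star_zero, mul_zero, mul_zero, map_zero]

/-- The equality case is symmetric in the two operators. -/
theorem mul_ringInverse_eq_comm {B C : H →L[ℂ] H} (hB : IsStrictlyPositive B)
    (hC : IsStrictlyPositive C) :
    B * Ring.inverse C = condExp M₀ B * Ring.inverse (condExp M₀ C) ↔
      C * Ring.inverse B = condExp M₀ C * Ring.inverse (condExp M₀ B) := by
  have key : ∀ {B C : H →L[ℂ] H}, IsStrictlyPositive B → IsStrictlyPositive C →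
      B * Ring.inverse C = condExp M₀ B * Ring.inverse (condExp M₀ C) →
      C * Ring.inverse B = condExp M₀ C * Ring.inverse (condExp M₀ B) := by
    intro B C hB hC h
    have hτ := (isStrictlyPositive_condExp M₀ hB).isUnit
    have hσ := (isStrictlyPositive_condExp M₀ hC).isUnit
    -- `X Y⁻¹` and `Y X⁻¹` are mutually inverse, so the second identity is the inverse of the first.
    have hleft : ∀ {X Y : H →L[ℂ] H}, IsUnit X → IsUnit Y →
        (X * Ring.inverse Y) * (Y * Ring.inverse X) = 1 := fun {X Y} hX hY => by
      rw [mul_assoc, ← mul_assoc _ Y, Ring.inverse_mul_cancel _ hY, one_mul,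
        Ring.mul_inverse_cancel _ hX]
    refine left_inv_eq_right_inv (hleft hC.isUnit hB.isUnit) ?_
    rw [h, hleft hτ hσ]
  exact ⟨key hB hC, key hC hB⟩

/-- Adding a multiple of `B` to `A` does not change the equality case. -/
theorem add_smul_mul_ringInverse_eq_iff {A B : H →L[ℂ] H} (hB : IsStrictlyPositive B) (t : ℝ) :
    (A + t • B) * Ring.inverse B = condExp M₀ (A + t • B) * Ring.inverse (condExp M₀ B) ↔
      A * Ring.inverse B = condExp M₀ A * Ring.inverse (condExp M₀ B) := by
  rw [map_add, LinearMap.map_smul_of_tower, add_mul, add_mul, smul_mul_assoc, smul_mul_assoc,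
    Ring.mul_inverse_cancel _ hB.isUnit,
    Ring.mul_inverse_cancel _ (isStrictlyPositive_condExp M₀ hB).isUnit, add_left_inj]

/-- Equality of the Belavkin-Staszewski entropies. -/
theorem bsEntropy_condExp_eq_iff {A B : H →L[ℂ] H} (hA : IsStrictlyPositive A)
    (hB : IsStrictlyPositive B) :
    bsEntropy A B = bsEntropy (condExp M₀ A) (condExp M₀ B) ↔
      A * Ring.inverse B = condExp M₀ A * Ring.inverse (condExp M₀ B) := by
  have hE := isTracePreservingCondExp_condExp M₀
  have hEA := isStrictlyPositive_condExp M₀ hA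
  have hEB := isStrictlyPositive_condExp M₀ hB
  have hd := isStrictlyPositive_rnDeriv hA hB
  have hd' := isStrictlyPositive_rnDeriv hEA hEB
  let _ := (finite_spectrum_real (rnDeriv B A)).fintype
  let _ := (finite_spectrum_real (rnDeriv (condExp M₀ B) (condExp M₀ A))).fintype
  obtain ⟨w, hw⟩ := exists_re_tr_mul_cfc_eq_sum (rnDeriv B A) B
  obtain ⟨v, hv⟩ := exists_re_tr_mul_cfc_eq_sum (rnDeriv (condExp M₀ B) (condExp M₀ A))
    (condExp M₀ B)
  -- Both spectra are pooled, the one on the `E` side with negated weights.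
  let c := Sum.elim w fun i => -v i
  let x := Sum.elim (fun i : spectrum ℝ (rnDeriv B A) => (i : ℝ))
    fun i : spectrum ℝ (rnDeriv (condExp M₀ B) (condExp M₀ A)) => (i : ℝ)
  have hsum : ∀ h : ℝ → ℝ, ∑ i, c i * h (x i) = (tr (B * cfc h (rnDeriv B A))).re -
      (tr (condExp M₀ B * cfc h (rnDeriv (condExp M₀ B) (condExp M₀ A)))).re := by
    intro h
    rw [hw, hv, Fintype.sum_sum_type]
    simp [c, x, sub_eq_add_neg]
  have hx : ∀ i, 0 < x i := by
    rintro (i | i)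
    · exact hd.spectrum_pos i.2
    · exact hd'.spectrum_pos i.2
  have h0 : ∑ i, c i = 0 := by
    have := hsum fun _ => 1
    rw [cfc_const_one ℝ _ hd.nonneg.isSelfAdjoint, cfc_const_one ℝ _ hd'.nonneg.isSelfAdjoint,
      mul_one, mul_one, hE.tr_apply, sub_self] at this
    simpa using this
  have h1 : ∑ i, c i * x i = 0 := by
    rw [hsum fun x => x, cfc_id' ℝ _ hd.nonneg.isSelfAdjoint,
      cfc_id' ℝ _ hd'.nonneg.isSelfAdjoint, tr_mul_rnDeriv hB, tr_mul_rnDeriv hEB,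
      hE.tr_apply, sub_self]
  have hC : ∀ t : ℝ, 0 < t → IsStrictlyPositive (A + t • B) := fun t ht =>
    hA.add_nonneg (IsStrictlyPositive.smul ht hB).nonneg
  have hgap : ∀ t, 0 < t → ∑ i, c i * (x i + t)⁻¹ =
      (tr (B * Ring.inverse (A + t • B) * B) - tr (condExp M₀ B *
        Ring.inverse (condExp M₀ (A + t • B)) * condExp M₀ B)).re := by
    intro t ht
    rw [hsum fun x => (x + t)⁻¹, tr_mul_cfc_resolvent hA hB ht, tr_mul_cfc_resolvent hEA hEB ht,
      map_add, LinearMap.map_smul_of_tower, Complex.sub_re]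
  have hres : ∀ t, 0 < t → 0 ≤ ∑ i, c i * (x i + t)⁻¹ := fun t ht => by
    rw [hgap t ht]
    exact (Complex.le_def.1 (tr_gap_nonneg M₀ hB (hC t ht))).1
  have hzero : ∀ t, 0 < t → (∑ i, c i * (x i + t)⁻¹ = 0 ↔
      A * Ring.inverse B = condExp M₀ A * Ring.inverse (condExp M₀ B)) := fun t ht => by
    rw [hgap t ht, ← add_smul_mul_ringInverse_eq_iff M₀ hB t,
      ← mul_ringInverse_eq_comm M₀ hB (hC t ht), ← tr_gap_eq_zero_iff M₀ hB (hC t ht)]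
    refine ⟨fun h => ?_, fun h => by rw [h, Complex.zero_re]⟩
    -- Only the real part is known to vanish; the order on `ℂ` makes the gap real.
    have him := (Complex.le_def.1 (tr_gap_nonneg M₀ hB (hC t ht))).2
    exact Complex.ext h him.symm
  rw [bsEntropy, bsEntropy, neg_inj, ← sub_eq_zero, ← hsum,
    sum_negMulLog_eq_zero_iff hx h0 h1 hres]
  exact ⟨fun h => (hzero 1 one_pos).1 (h 1 one_pos), fun h t ht => (hzero t ht).2 h⟩

/-! ### The multiplicative domain -/

theorem ringInverse_eq_rpow_mul {B : H →L[ℂ] H} (hB : IsStrictlyPositive B) :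
    B ^ (-(1 / 2) : ℝ) * B ^ (-(1 / 2) : ℝ) = Ring.inverse B := by
  have h2 := CFC.rpow_neg_mul_rpow (1 / 2 : ℝ) hB
  refine left_inv_eq_right_inv (a := B) ?_ (Ring.mul_inverse_cancel _ hB.isUnit)
  conv_lhs => enter [2]; rw [← rpow_half_mul_self hB]
  rw [mul_assoc, ← mul_assoc _ (B ^ (1 / 2 : ℝ)) (B ^ (1 / 2 : ℝ)), h2, one_mul, h2]

theorem genCondExp_rnDeriv {B : H →L[ℂ] H} (hB : IsStrictlyPositive B) (A : H →L[ℂ] H) :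
    genCondExp M₀ B (rnDeriv B A) = rnDeriv (condExp M₀ B) (condExp M₀ A) := by
  have h1 := CFC.rpow_mul_rpow_neg (1 / 2 : ℝ) hB
  have h2 := CFC.rpow_neg_mul_rpow (1 / 2 : ℝ) hB
  have : B ^ (1 / 2 : ℝ) * rnDeriv B A * B ^ (1 / 2 : ℝ) = A := by
    calc _ = (B ^ (1 / 2 : ℝ) * B ^ (-(1 / 2) : ℝ)) * A *
          (B ^ (-(1 / 2) : ℝ) * B ^ (1 / 2 : ℝ)) := by simp only [rnDeriv, mul_assoc]
      _ = A := by rw [h1, h2, one_mul, mul_one]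
  rw [genCondExp, this, rnDeriv]

/-- The Radon-Nikodym derivative lies in the multiplicative domain exactly if
`E(A B⁻¹ A) = E(A) E(B)⁻¹ E(A)`. -/
theorem rnDeriv_mem_multDomain_iff {A B : H →L[ℂ] H} (hA : IsStrictlyPositive A)
    (hB : IsStrictlyPositive B) :
    rnDeriv B A ∈ multDomain M₀ B ↔ condExp M₀ (A * Ring.inverse B * A) =
      condExp M₀ A * Ring.inverse (condExp M₀ B) * condExp M₀ A := by
  have hEA := isStrictlyPositive_condExp M₀ hA
  have hEB := isStrictlyPositive_condExp M₀ hB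
  have hd := (isStrictlyPositive_rnDeriv hA hB).nonneg.isSelfAdjoint.star_eq
  have hd' := (isStrictlyPositive_rnDeriv hEA hEB).nonneg.isSelfAdjoint.star_eq
  -- The square of a derivative is again a derivative, so `genCondExp_rnDeriv` also evaluates
  -- `E_B(d²)`. As `d` is self-adjoint, the two defining conditions coincide.
  have hsq : ∀ {X Y : H →L[ℂ] H}, IsStrictlyPositive Y →
      rnDeriv Y X * rnDeriv Y X = rnDeriv Y (X * Ring.inverse Y * X) := fun {X Y} hY => by
    rw [← ringInverse_eq_rpow_mul hY]
    simp only [rnDeriv, mul_assoc]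
  have hu := (IsStrictlyPositive.rpow (condExp M₀ B) (-(1 / 2) : ℝ) hEB).isUnit
  simp only [multDomain, Set.mem_ofPred_eq, hd, genCondExp_rnDeriv M₀ hB, hd', hsq hB, hsq hEB,
    and_self]
  rw [rnDeriv, rnDeriv, hu.mul_left_inj, hu.mul_right_inj]

end CondExp

end QuantumBS

/-! ### The equivalences -/

theorem mainTheorem6 {H : Type*} [NormedAddCommGroup H] [InnerProductSpace ℂ H]
    [CompleteSpace H] [FiniteDimensional ℂ H]
    (M₀ : StarSubalgebra ℂ (H →L[ℂ] H)) (ρ₀ ρ₁ : H →L[ℂ] H)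
    (hρ₀ : QuantumBS.IsDensity ρ₀) (hρ₁ : QuantumBS.IsDensity ρ₁)
    (hρ₀_inv : IsUnit ρ₀) (hρ₁_inv : IsUnit ρ₁) :
    List.TFAE
      [QuantumBS.bsEntropy ρ₁ ρ₀ =
          QuantumBS.bsEntropy (QuantumBS.condExp M₀ ρ₁) (QuantumBS.condExp M₀ ρ₀),
        QuantumBS.rnDeriv ρ₀ ρ₁ ∈ QuantumBS.multDomain M₀ ρ₀,
        ρ₁ * Ring.inverse ρ₀ ∈ M₀,
        ρ₁ * Ring.inverse ρ₀ =
          QuantumBS.condExp M₀ ρ₁ * Ring.inverse (QuantumBS.condExp M₀ ρ₀)] := by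
  have hB := hρ₀_inv.isStrictlyPositive hρ₀.nonneg
  have hA := hρ₁_inv.isStrictlyPositive hρ₁.nonneg
  have hE := QuantumBS.isTracePreservingCondExp_condExp M₀
  tfae_have 1 ↔ 4 := QuantumBS.bsEntropy_condExp_eq_iff M₀ hA hB
  tfae_have 2 → 4 := by
    intro h
    rw [QuantumBS.rnDeriv_mem_multDomain_iff M₀ hA hB] at h
    -- Taking traces in `h` closes the gap for the pair `(ρ₁, ρ₀)`.
    rw [← QuantumBS.tr_gap_eq_zero_iff M₀ hA hB, ← h, hE.tr_apply, sub_self]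
  tfae_have 4 → 2 := by
    intro h
    rw [QuantumBS.rnDeriv_mem_multDomain_iff M₀ hA hB, h, QuantumBS.condExp_mul_left M₀
      (mul_mem (hE.mem ρ₁) (QuantumBS.ringInverse_condExp_mem M₀ hB))]
  tfae_have 4 → 3 := by
    intro h
    rw [h]
    exact mul_mem (hE.mem ρ₁) (QuantumBS.ringInverse_condExp_mem M₀ hB)
  tfae_have 3 → 4 := by
    intro h
    -- `ρ₁ ρ₀⁻¹ E(ρ₀) = E(ρ₁ ρ₀⁻¹ ρ₀) = E(ρ₁)`.
    rw [Ring.eq_mul_inverse_iff_mul_eq _ _ _ (QuantumBS.isStrictlyPositive_condExp M₀ hB).isUnit,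
      ← QuantumBS.condExp_mul_left M₀ h, mul_assoc, Ring.inverse_mul_cancel _ hρ₀_inv, mul_one]
  tfae_finish
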